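/- For a real number $\rho$ let the Euler–Frobenius polynomials be given by $P_{0,\rho}(x)=1$ and $$P_{n,\rho}(x)=\bigl(nx+\rho(1-x)\bigr)P_{n-1,\rho}(x)+x(1-x)P_{n-1,\rho}'(x)\qquad(n\ge 1),$$ and write $P_{n,\rho}(x)=\sum_{k=0}^n A_{n,k,\rho}x^k$. For $0\le\rho\le1$ let the Euler–Frobenius distribution with parameters $(n,\rho)$ be the probability distribution on $\{0,\dots,n\}$ that gives mass $A_{n,k,\rho}/n!$ to $k$. For arbitrary real $\rho$ let the Euler–Frobenius distribution with parameters $(n,\rho)$ be the distribution of $Y-\lfloor\rho\rfloor$, where $Y$ has the Euler–Frobenius distribution with parameters $(n,\rho-\lfloor\rho\rfloor)$ (for $n\ge 1$ the two definitions agree when $0\le\rho\le1$). The $m$-th cumulant of a random variable $X$ is $\kappa_m(X)=\frac{d^m}{dt^m}\log \mathbb E\,e^{tX}\big|_{t=0}$. Let $U_1,U_2,\dots$ be independent random variables uniformly distributed on $[0,1]$, and let $S_n=\sum_{i=1}^nU_i$. **Theorem.** Let $\rho\in\mathbb R$, and let $X_{n,\rho}$ be any random variable that has the Euler–Frobenius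 distribution with parameters $(n,\rho)$. Then all exponential moments of $X_{n,\rho}$ are finite, and for $n\ge1$ the rounded sum $Z_{n,\rho}=\lfloor S_n+1-\rho\rfloor$ has the same distribution as $X_{n,\rho}$. Moreover, $$\mathbb E X_{n,\rho}=\frac{n+1}{2}-\rho\quad(n\ge1),\qquad \operatorname{Var}X_{n,\rho}=\frac{n+1}{12}\quad(n\ge2).$$ More generally, for $2\le m\le n$ the $m$-th cumulant of $X_{n,\rho}$ is independent of $\rho$ and is given by $$\kappa_m(X_{n,\rho})=\kappa_m(S_{n+1})=(n+1)\,\kappa_m(U_1)=(n+1)\frac{B_m}{m},$$ where $B_m$ is the $m$-th Bernoulli number. In particular, $\kappa_m(X_{n,\rho})=0$ if $m$ is odd and $3\le m\le n$. -/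

import Mathlib

open MeasureTheory ProbabilityTheory Polynomial

/-- The Euler–Frobenius polynomial `P_{n,ρ}`, defined by `P_{0,ρ} = 1` and
`P_{n,ρ}(x) = (n x + ρ (1 - x)) P_{n-1,ρ}(x) + x (1 - x) P_{n-1,ρ}'(x)` for `n ≥ 1`. -/
noncomputable def eulerFrobeniusPoly (ρ : ℝ) : ℕ → ℝ[X]
  | 0 => 1
  | n + 1 => (((n : ℝ[X]) + 1) * X + C ρ * (1 - X)) * eulerFrobeniusPoly ρ n
      + X * (1 - X) * derivative (eulerFrobeniusPoly ρ n)

/-- The Euler–Frobenius number `A_{n,k,ρ}`, the coefficient of `x ^ k` in `P_{n,ρ}`. -/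
noncomputable def eulerFrobeniusNumber (n k : ℕ) (ρ : ℝ) : ℝ :=
  (eulerFrobeniusPoly ρ n).coeff k

/-- The Euler–Frobenius distribution with parameter `ρ ∈ [0, 1]`, as a measure on `ℤ`:
the point `k ∈ {0, …, n}` has mass `A_{n,k,ρ} / n!`. -/
noncomputable def eulerFrobeniusDistUnit (n : ℕ) (ρ : ℝ) : Measure ℤ :=
  ∑ k ∈ Finset.range (n + 1),
    ENNReal.ofReal (eulerFrobeniusNumber n k ρ / (n.factorial : ℝ)) • Measure.dirac (k : ℤ)

/-- The Euler–Frobenius distribution for an arbitrary real parameter `ρ`: the law of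
`Y - ⌊ρ⌋`, where `Y` has the Euler–Frobenius distribution with parameter `ρ - ⌊ρ⌋`. -/
noncomputable def eulerFrobeniusDist (n : ℕ) (ρ : ℝ) : Measure ℤ :=
  (eulerFrobeniusDistUnit n (Int.fract ρ)).map (fun k => k - ⌊ρ⌋)

/-- The `m`-th cumulant of a real random variable `X`: the `m`-th derivative at `0` of
`t ↦ log 𝔼[exp (t X)]`. -/
noncomputable def cumulant {Ω : Type*} [MeasurableSpace Ω] (m : ℕ) (X : Ω → ℝ)
    (μ : Measure Ω) : ℝ :=
  iteratedDeriv m (cgf X μ) 0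

theorem eulerFrobeniusPoly_natDegree_le (ρ : ℝ) (n : ℕ) :
    (eulerFrobeniusPoly ρ n).natDegree ≤ n := by
  induction n with
  | zero => simp [eulerFrobeniusPoly]
  | succ n ih =>
    rw [natDegree_le_iff_coeff_eq_zero]
    intro k hk
    have h0 : ∀ j, n < j → (eulerFrobeniusPoly ρ n).coeff j = 0 :=
      fun j hj => coeff_eq_zero_of_natDegree_lt (by omega)
    obtain ⟨j, rfl⟩ : ∃ j, k = j + 2 := ⟨k - 2, by omega⟩
    have e : eulerFrobeniusPoly ρ (n + 1)
        = ((n : ℝ[X]) + 1) * (X * eulerFrobeniusPoly ρ n)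
          + C ρ * eulerFrobeniusPoly ρ n - C ρ * (X * eulerFrobeniusPoly ρ n)
          + X * derivative (eulerFrobeniusPoly ρ n)
          - X * (X * derivative (eulerFrobeniusPoly ρ n)) := by
      rw [eulerFrobeniusPoly]; ring
    have hc : ((n : ℝ[X]) + 1) = C ((n : ℝ) + 1) := by simp
    rw [e, hc]
    simp only [coeff_add, coeff_sub, coeff_C_mul, coeff_X_mul, coeff_derivative,
      h0 (j + 1) (by omega), h0 (j + 1 + 1) (by omega)]
    ring_nf

theorem eulerFrobeniusNumber_eq_zero {n k : ℕ} (h : n < k) (ρ : ℝ) :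
    eulerFrobeniusNumber n k ρ = 0 :=
  coeff_eq_zero_of_natDegree_lt
    (lt_of_le_of_lt (eulerFrobeniusPoly_natDegree_le ρ n) h)

theorem eulerFrobeniusNumber_succ_zero (n : ℕ) (ρ : ℝ) :
    eulerFrobeniusNumber (n + 1) 0 ρ = ρ * eulerFrobeniusNumber n 0 ρ := by
  simp [eulerFrobeniusNumber, eulerFrobeniusPoly, mul_coeff_zero]

theorem eulerFrobeniusNumber_succ_succ (n k : ℕ) (ρ : ℝ) :
    eulerFrobeniusNumber (n + 1) (k + 1) ρ
      = ((k : ℝ) + 1 + ρ) * eulerFrobeniusNumber n (k + 1) ρ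
        + ((n : ℝ) + 1 - k - ρ) * eulerFrobeniusNumber n k ρ := by
  have e : eulerFrobeniusPoly ρ (n + 1)
      = ((n : ℝ[X]) + 1) * (X * eulerFrobeniusPoly ρ n)
        + C ρ * eulerFrobeniusPoly ρ n - C ρ * (X * eulerFrobeniusPoly ρ n)
        + X * derivative (eulerFrobeniusPoly ρ n)
        - X * (X * derivative (eulerFrobeniusPoly ρ n)) := by
    rw [eulerFrobeniusPoly]; ring
  have hc : ((n : ℝ[X]) + 1) = C ((n : ℝ) + 1) := by simp
  have hx : (X * derivative (eulerFrobeniusPoly ρ n)).coeff k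
      = k * (eulerFrobeniusPoly ρ n).coeff k := by
    cases k with
    | zero => simp
    | succ k => rw [coeff_X_mul, coeff_derivative]; push_cast; ring
  simp only [eulerFrobeniusNumber]
  rw [e, hc]
  simp only [coeff_add, coeff_sub, coeff_C_mul, coeff_X_mul, coeff_derivative, hx]
  ring

theorem eulerFrobeniusNumber_nonneg (n k : ℕ) {ρ : ℝ} (h0 : 0 ≤ ρ) (h1 : ρ ≤ 1) :
    0 ≤ eulerFrobeniusNumber n k ρ := by
  induction n generalizing k with
  | zero =>
    simp only [eulerFrobeniusNumber, eulerFrobeniusPoly, coeff_one]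
    split_ifs <;> norm_num
  | succ n ih =>
    cases k with
    | zero =>
      rw [eulerFrobeniusNumber_succ_zero]
      exact mul_nonneg h0 (ih 0)
    | succ k =>
      rw [eulerFrobeniusNumber_succ_succ]
      refine add_nonneg (mul_nonneg (by positivity) (ih _)) ?_
      rcases le_or_gt k n with hk | hk
      · have : (k : ℝ) ≤ n := by exact_mod_cast hk
        exact mul_nonneg (by linarith) (ih _)
      · rw [eulerFrobeniusNumber_eq_zero hk, mul_zero]

theorem eulerFrobeniusPoly_eval_one (n : ℕ) (ρ : ℝ) :
    (eulerFrobeniusPoly ρ n).eval 1 = (n.factorial : ℝ) := by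
  induction n with
  | zero => simp [eulerFrobeniusPoly]
  | succ n ih => simp [eulerFrobeniusPoly, ih, Nat.factorial_succ]

theorem eulerFrobeniusNumber_sum (n : ℕ) (ρ : ℝ) :
    ∑ k ∈ Finset.range (n + 1), eulerFrobeniusNumber n k ρ = (n.factorial : ℝ) := by
  rw [← eulerFrobeniusPoly_eval_one n ρ,
    eval_eq_sum_range' (Nat.lt_succ_of_le (eulerFrobeniusPoly_natDegree_le ρ n))]
  simp [eulerFrobeniusNumber]

theorem eulerFrobeniusDistUnit_isProbabilityMeasure (n : ℕ) {ρ : ℝ} (h0 : 0 ≤ ρ)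
    (h1 : ρ ≤ 1) : IsProbabilityMeasure (eulerFrobeniusDistUnit n ρ) := by
  constructor
  have hf : (n.factorial : ℝ) ≠ 0 := by positivity
  simp only [eulerFrobeniusDistUnit, Measure.finsetSum_apply, Measure.smul_apply, measure_univ,
    smul_eq_mul, mul_one]
  rw [← ENNReal.ofReal_sum_of_nonneg, ← Finset.sum_div, eulerFrobeniusNumber_sum, div_self hf,
    ENNReal.ofReal_one]
  intro k _
  exact div_nonneg (eulerFrobeniusNumber_nonneg n k h0 h1) (by positivity)

instance eulerFrobeniusDist_isProbabilityMeasure (n : ℕ) (ρ : ℝ) :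
    IsProbabilityMeasure (eulerFrobeniusDist n ρ) := by
  have := eulerFrobeniusDistUnit_isProbabilityMeasure n (Int.fract_nonneg ρ)
    (Int.fract_lt_one ρ).le
  exact Measure.isProbabilityMeasure_map (by fun_prop)

theorem eulerFrobeniusPoly_zero_eq (n : ℕ) :
    eulerFrobeniusPoly 0 (n + 1) = X * eulerFrobeniusPoly 1 (n + 1) := by
  induction n with
  | zero => simp [eulerFrobeniusPoly]
  | succ n ih =>
    rw [eulerFrobeniusPoly, ih, eulerFrobeniusPoly.eq_2 1 (n + 1)]
    simp only [derivative_mul, derivative_X, C_0, C_1]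
    push_cast
    ring

/-- The definition for real parameters agrees with the one for parameters in `[0, 1]`. -/
theorem eulerFrobeniusDist_eq_unit (n : ℕ) (hn : 1 ≤ n) {ρ : ℝ} (h0 : 0 ≤ ρ) (h1 : ρ ≤ 1) :
    eulerFrobeniusDist n ρ = eulerFrobeniusDistUnit n ρ := by
  rcases h1.lt_or_eq with h | rfl
  · have hfl : ⌊ρ⌋ = 0 := Int.floor_eq_zero_iff.2 ⟨h0, h⟩
    have hfr : Int.fract ρ = ρ := Int.fract_eq_self.2 ⟨h0, h⟩
    simp [eulerFrobeniusDist, hfl, hfr]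
  · obtain ⟨n, rfl⟩ : ∃ j, n = j + 1 := ⟨n - 1, by omega⟩
    have hs : ∀ k, eulerFrobeniusNumber (n + 1) (k + 1) 0 = eulerFrobeniusNumber (n + 1) k 1 := by
      intro k
      simp only [eulerFrobeniusNumber, eulerFrobeniusPoly_zero_eq, coeff_X_mul]
    have hz : eulerFrobeniusNumber (n + 1) 0 0 = 0 := by
      rw [eulerFrobeniusNumber_succ_zero, zero_mul]
    have hl : eulerFrobeniusNumber (n + 1) (n + 1) 1 = 0 := by
      rw [← hs, eulerFrobeniusNumber_eq_zero (by omega)]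
    have hm : Measurable (fun k : ℤ => k - 1) := by fun_prop
    simp only [eulerFrobeniusDist, eulerFrobeniusDistUnit, Int.fract_one, Int.floor_one]
    rw [Finset.sum_range_succ', Finset.sum_range_succ _ (n + 1), hz, hl]
    simp only [zero_div, ENNReal.ofReal_zero, zero_smul, add_zero, hs]
    rw [Measure.map_finset_sum hm.aemeasurable]
    simp [Measure.map_smul, Measure.map_dirac' hm]

/-! Put `E t = (exp t - 1) / t`, the moment generating function of a uniform variable. Dividing the
recursion for `P_n` by `(1 - x) ^ (n + 1)` at `x = exp t` shows that `exp (ρ t) P_n(exp t) / (1 -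
exp t) ^ (n + 1)` is the `n`-th derivative of `exp (ρ t) / (1 - exp t)`. The latter is `-1 / t` plus
an analytic function, so `exp (ρ t) P_n(exp t) / n! = E ^ (n + 1) (1 + O(t ^ (n + 1)))`
(`exists_exp_mul_eval_eulerFrobeniusPoly`). Taking logarithms, the cumulants of orders `1` to `n`
are those of `S_{n+1}`, except that `ρ` is subtracted from the mean. Bernoulli numbers enter because
`t (log E)' + 1 = t exp t / (exp t - 1)`.

The law of the rounded sum is a separate argument. The distribution function of `S_n` is the `n`-th
backward difference of `x₊ ^ n / n!`, so the rounded sum has as its masses one further difference, a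
cardinal B-spline. The B-spline recurrence is the recurrence of the Euler–Frobenius numbers
(`eulerFrobeniusNumber_eq_backwardDiff`). -/

/-! ### Taylor coefficients of `log ((exp t - 1) / t)` and Bernoulli numbers -/

open Filter Topology in
theorem iteratedDeriv_id_mul_zero {f : ℝ → ℝ} (hf : AnalyticAt ℝ f 0) (m : ℕ) :
    iteratedDeriv m (fun t => t * f t) 0 = m * iteratedDeriv (m - 1) f 0 := by
  have h := iteratedDeriv_mul (n := m) (f := fun t : ℝ => t) (g := f) (x := 0)
    contDiffAt_id (hf.contDiffAt)
  have e : (fun t => t * f t) = (fun t : ℝ => t) * f := rfl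
  rw [e, h]
  simp only [iteratedDeriv_fun_id_zero]
  rcases m with _ | m
  · simp
  · rw [Finset.sum_eq_single 1]
    · simp
    · intro b _ hb
      simp [hb]
    · simp

/-- The function `t ↦ (exp t - 1) / t`, extended analytically to `t = 0`. -/
noncomputable def expSlope : ℝ → ℝ := dslope Real.exp 0

theorem mul_expSlope (t : ℝ) : t * expSlope t = Real.exp t - 1 := by
  have := sub_smul_dslope Real.exp 0 t
  simpa [expSlope] using this

theorem expSlope_zero : expSlope 0 = 1 := by
  simp [expSlope, dslope_same]

theorem expSlope_pos (t : ℝ) : 0 < expSlope t := by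
  rcases lt_trichotomy t 0 with h | rfl | h
  · have h1 := mul_expSlope t
    have h2 := Real.exp_lt_one_iff.2 h
    by_contra! h3
    nlinarith [mul_nonneg_of_nonpos_of_nonpos h.le h3]
  · simp [expSlope_zero]
  · have h1 := mul_expSlope t
    have h2 := Real.one_lt_exp_iff.2 h
    by_contra! h3
    nlinarith [mul_nonpos_of_nonneg_of_nonpos h.le h3]

theorem analyticAt_expSlope : AnalyticAt ℝ expSlope 0 := by
  obtain ⟨p, hp⟩ := (analyticAt_rexp : AnalyticAt ℝ Real.exp 0)
  exact ⟨_, hp.has_fpower_series_dslope_fslope⟩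

open Filter Topology in
theorem eventually_mul_deriv_expSlope :
    ∀ᶠ t in 𝓝 (0 : ℝ), DifferentiableAt ℝ expSlope t ∧
      t * deriv expSlope t = Real.exp t - expSlope t := by
  filter_upwards [analyticAt_expSlope.eventually_analyticAt] with t ht
  have hd := ht.differentiableAt
  refine ⟨hd, ?_⟩
  have h1 : HasDerivAt (fun t => t * expSlope t) (1 * expSlope t + t * deriv expSlope t) t :=
    (hasDerivAt_id t).mul hd.hasDerivAt
  have h2 : HasDerivAt (fun t => t * expSlope t) (Real.exp t) t := by
    simp only [mul_expSlope]
    exact (Real.hasDerivAt_exp t).sub_const 1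
  linarith [h1.unique h2]

theorem analyticAt_exp_div_expSlope :
    AnalyticAt ℝ (fun t => Real.exp t / expSlope t) 0 :=
  analyticAt_rexp.div analyticAt_expSlope (expSlope_pos 0).ne'

/-- The Leibniz rule applied to `β t * (exp t - 1) = t * exp t` gives the recurrence that determines
`bernoulli'`. The numerator `exp t` selects the convention in which the first Bernoulli number is
`+1/2`. -/
theorem iteratedDeriv_exp_div_expSlope (k : ℕ) :
    iteratedDeriv k (fun t => Real.exp t / expSlope t) 0 = (bernoulli' k : ℝ) := by
  set β : ℝ → ℝ := fun t => Real.exp t / expSlope t with hβ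
  have key : ∀ n : ℕ, ∑ k ∈ Finset.range n, (n.choose k : ℝ) * iteratedDeriv k β 0 = n := by
    intro n
    have e : β * (fun t => Real.exp t - 1) = fun t => t * Real.exp t := by
      ext t
      have := (expSlope_pos t).ne'
      simp only [hβ, Pi.mul_apply, ← mul_expSlope]
      field_simp
    have h := iteratedDeriv_mul (n := n) (f := β) (g := fun t => Real.exp t - 1) (x := 0)
      analyticAt_exp_div_expSlope.contDiffAt (by fun_prop)
    rw [e, iteratedDeriv_id_mul_zero analyticAt_rexp, Finset.sum_range_succ] at h
    have h0 : ∀ j, iteratedDeriv (j + 1) (fun t => Real.exp t - 1) 0 = 1 := by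
      intro j
      rw [iteratedDeriv_succ']
      simp [iteratedDeriv_eq_iterate]
    have h1 : ∀ j, iteratedDeriv j Real.exp 0 = 1 := by
      intro j
      simp [iteratedDeriv_eq_iterate]
    rw [h1] at h
    simp only [Nat.sub_self, iteratedDeriv_zero, Real.exp_zero, sub_self, mul_zero, add_zero,
      mul_one] at h
    rw [h]
    refine Finset.sum_congr rfl fun k hk => ?_
    obtain ⟨j, hj⟩ : ∃ j, n - k = j + 1 := ⟨n - k - 1, by have := Finset.mem_range.1 hk; omega⟩
    rw [hj, h0, mul_one]
  induction k using Nat.strong_induction_on with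
  | _ k ih =>
    have h1 := key (k + 1)
    have h2 : (∑ j ∈ Finset.range (k + 1), ((k + 1).choose j : ℝ) * (bernoulli' j : ℝ))
        = ((k + 1 : ℕ) : ℝ) := by exact_mod_cast sum_bernoulli' (k + 1)
    rw [Finset.sum_range_succ] at h1 h2
    have h3 : ∑ j ∈ Finset.range k, ((k + 1).choose j : ℝ) * iteratedDeriv j β 0
        = ∑ j ∈ Finset.range k, ((k + 1).choose j : ℝ) * (bernoulli' j : ℝ) :=
      Finset.sum_congr rfl fun j hj => by rw [ih j (Finset.mem_range.1 hj)]
    have h4 : (((k + 1).choose k : ℕ) : ℝ) ≠ 0 := by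
      simp; positivity
    refine mul_left_cancel₀ h4 ?_
    linarith

theorem analyticAt_log_expSlope : AnalyticAt ℝ (fun t => Real.log (expSlope t)) 0 :=
  analyticAt_expSlope.log (expSlope_pos 0)

-- Multiplying the logarithmic derivative by `t` turns it into the Bernoulli generating function
-- minus `1`. The factor `m` from the `m`-th derivative of `t * f t` at `0` becomes the denominator.
open Filter Topology in
theorem iteratedDeriv_log_expSlope {m : ℕ} (hm : 1 ≤ m) :
    iteratedDeriv m (fun t => Real.log (expSlope t)) 0 = (bernoulli' m : ℝ) / m := by
  have h : (fun t => t * deriv (fun t => Real.log (expSlope t)) t)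
      =ᶠ[𝓝 0] fun t => -1 + Real.exp t / expSlope t := by
    filter_upwards [eventually_mul_deriv_expSlope] with t ht
    have := (expSlope_pos t).ne'
    rw [(ht.1.hasDerivAt.log this).deriv, mul_div_assoc', ht.2]
    field_simp
    ring
  have h1 := h.iteratedDeriv_eq m
  rw [iteratedDeriv_id_mul_zero analyticAt_log_expSlope.deriv, ← iteratedDeriv_succ',
    Nat.sub_add_cancel hm, iteratedDeriv_const_add (by omega),
    iteratedDeriv_exp_div_expSlope] at h1
  rw [← h1]
  have : (m : ℝ) ≠ 0 := by positivity
  field_simp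

/-! ### Expansion of the generating polynomial at `t = 0` -/

open Filter Topology in
/-- Near `0`, `exp (ρ t) P_{n,ρ}(exp t)` agrees with `n! ((exp t - 1) / t) ^ (n + 1)` up to a
multiple of `(1 - exp t) ^ (n + 1)`. -/
theorem exists_exp_mul_eval_eulerFrobeniusPoly (ρ : ℝ) (n : ℕ) :
    ∃ a : ℝ → ℝ, AnalyticAt ℝ a 0 ∧ ∀ᶠ t in 𝓝 (0 : ℝ),
      Real.exp (ρ * t) * (eulerFrobeniusPoly ρ n).eval (Real.exp t)
        = n.factorial * expSlope t ^ (n + 1) + (1 - Real.exp t) ^ (n + 1) * a t := by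
  induction n with
  | zero =>
    have hd : AnalyticAt ℝ (dslope (fun t => Real.exp (ρ * t) - expSlope t) 0) 0 := by
      have : AnalyticAt ℝ (fun t => Real.exp (ρ * t) - expSlope t) 0 :=
        (by fun_prop : AnalyticAt ℝ (fun t => Real.exp (ρ * t)) 0).sub analyticAt_expSlope
      obtain ⟨p, hp⟩ := this
      exact ⟨_, hp.has_fpower_series_dslope_fslope⟩
    -- This is the regular part `exp (ρ t) / (1 - exp t) + 1 / t`, extended analytically over `0`.
    refine ⟨fun t => -(dslope (fun t => Real.exp (ρ * t) - expSlope t) 0 t / expSlope t),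
      (hd.div analyticAt_expSlope (expSlope_pos 0).ne').neg, Eventually.of_forall fun t => ?_⟩
    have h1 := sub_smul_dslope (fun t => Real.exp (ρ * t) - expSlope t) 0 t
    have h2 := mul_expSlope t
    have h3 : 1 - Real.exp t = -(t * expSlope t) := by linarith
    have h4 := (expSlope_pos t).ne'
    simp only [sub_zero, smul_eq_mul, mul_zero, Real.exp_zero, expSlope_zero, sub_self] at h1
    simp only [eulerFrobeniusPoly, eval_one, h3]
    field_simp
    simp only [zero_add, pow_one, Nat.factorial_zero, Nat.cast_one, one_mul]
    linear_combination -(expSlope t) * h1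
  | succ n ih =>
    obtain ⟨a, ha, h⟩ := ih
    -- After division by `(1 - exp t) ^ (n + 1)`, passing from `n` to `n + 1` is differentiation in
    -- `t`, so the remainder is differentiated too.
    refine ⟨deriv a, ha.deriv, ?_⟩
    filter_upwards [h.eventually_nhds, ha.eventually_analyticAt, eventually_mul_deriv_expSlope]
      with t ht hat ⟨hE, hE'⟩
    set P := eulerFrobeniusPoly ρ n with hP
    have hexp := Real.hasDerivAt_exp t
    have h1 : HasDerivAt (fun t => Real.exp (ρ * t) * P.eval (Real.exp t))
        (Real.exp (ρ * t) * ρ * P.eval (Real.exp t)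
          + Real.exp (ρ * t) * ((derivative P).eval (Real.exp t) * Real.exp t)) t := by
      refine HasDerivAt.mul ?_ ?_
      · simpa using ((hasDerivAt_id t).const_mul ρ).exp
      · exact (P.hasDerivAt (Real.exp t)).comp t hexp
    have h2 : HasDerivAt (fun t => n.factorial * expSlope t ^ (n + 1)
        + (1 - Real.exp t) ^ (n + 1) * a t)
        (n.factorial * (((n + 1 : ℕ) : ℝ) * expSlope t ^ n * deriv expSlope t)
          + (((n + 1 : ℕ) : ℝ) * (1 - Real.exp t) ^ n * (-Real.exp t) * a t
            + (1 - Real.exp t) ^ (n + 1) * deriv a t)) t := by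
      refine HasDerivAt.add ?_ (HasDerivAt.mul ?_ hat.differentiableAt.hasDerivAt)
      · simpa using (hE.hasDerivAt.pow (n + 1)).const_mul (n.factorial : ℝ)
      · simpa using (hexp.const_sub 1).fun_pow (n + 1)
    have h3 := h1.unique (h2.congr_of_eventuallyEq ht)
    have h4 := ht.self_of_nhds
    have h5 : 1 - Real.exp t = -(t * expSlope t) := by linarith [mul_expSlope t]
    have hx : Real.exp t = expSlope t + t * deriv expSlope t := by linarith
    rw [eulerFrobeniusPoly, ← hP, Nat.factorial_succ]
    simp only [eval_add, eval_mul, eval_sub, eval_one, eval_X, eval_C, eval_natCast]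
    have e1 : Real.exp (ρ * t) * ((((n : ℝ) + 1) * Real.exp t + ρ * (1 - Real.exp t))
          * eval (Real.exp t) P + Real.exp t * (1 - Real.exp t)
          * eval (Real.exp t) (derivative P))
        = (n + 1) * Real.exp t * (Real.exp (ρ * t) * eval (Real.exp t) P)
          + (1 - Real.exp t) * (Real.exp (ρ * t) * ρ * P.eval (Real.exp t)
          + Real.exp (ρ * t) * ((derivative P).eval (Real.exp t) * Real.exp t)) := by ring
    rw [e1, h3, h4]
    push_cast
    -- For `t ≠ 0` this says that the derivative of `E / (1 - exp t) = -1 / t` is `1 / t ^ 2`, with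
    -- denominators cleared.
    have e2 : Real.exp t * expSlope t + (1 - Real.exp t) * deriv expSlope t = expSlope t ^ 2 := by
      rw [h5]
      linear_combination (expSlope t) * hx
    linear_combination ((n : ℝ) + 1) * n.factorial * expSlope t ^ n * e2

-- Since `log` vanishes at `1`, it factors as `log y = (y - 1) * dslope log 1 y`. Hence the
-- composite is divisible by `t ^ N`, and its derivatives of order below `N` vanish.
open Filter Topology in
theorem iteratedDeriv_log_one_add_pow_mul {b : ℝ → ℝ} (hb : AnalyticAt ℝ b 0) {m N : ℕ}
    (hm : m < N) :
    AnalyticAt ℝ (fun t => Real.log (1 + t ^ N * b t)) 0 ∧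
      iteratedDeriv m (fun t => Real.log (1 + t ^ N * b t)) 0 = 0 := by
  have hN : N ≠ 0 := by omega
  have hg : AnalyticAt ℝ (fun t => 1 + t ^ N * b t) 0 := by fun_prop
  have hlog : AnalyticAt ℝ (fun t => Real.log (1 + t ^ N * b t)) 0 :=
    hg.log (by simp [hN])
  refine ⟨hlog, ?_⟩
  refine (natCast_le_analyticOrderAt_iff_iteratedDeriv_eq_zero hlog).1 ?_ m hm
  rw [natCast_le_analyticOrderAt hlog]
  have hd : AnalyticAt ℝ (dslope Real.log 1) 1 := by
    obtain ⟨p, hp⟩ := (analyticAt_log (by norm_num) : AnalyticAt ℝ Real.log 1)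
    exact ⟨_, hp.has_fpower_series_dslope_fslope⟩
  refine ⟨fun t => b t * dslope Real.log 1 (1 + t ^ N * b t), ?_, Eventually.of_forall fun t => ?_⟩
  · exact hb.mul (AnalyticAt.fun_comp (by simpa [hN] using hd) hg)
  · have := sub_smul_dslope Real.log 1 (1 + t ^ N * b t)
    simp only [Real.log_one, sub_zero, smul_eq_mul, add_sub_cancel_left] at this ⊢
    rw [← this]
    ring

open Filter Topology in
/-- The derivatives at `0`, of orders `1 ≤ m ≤ n`, of the logarithm of
`exp (-c t) P_{n,ρ}(exp t) / n!`. -/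
theorem iteratedDeriv_log_eval_eulerFrobeniusPoly (ρ c : ℝ) {n m : ℕ} (hm : 1 ≤ m)
    (hmn : m ≤ n) :
    iteratedDeriv m (fun t => Real.log
        (Real.exp (-(c * t)) * ((eulerFrobeniusPoly ρ n).eval (Real.exp t) / n.factorial))) 0
      = (n + 1) * (bernoulli' m : ℝ) / m - if m = 1 then ρ + c else 0 := by
  obtain ⟨a, ha, h⟩ := exists_exp_mul_eval_eulerFrobeniusPoly ρ n
  -- Dividing the expansion by `n! E ^ (n + 1)` and using `1 - exp t = -t E` leaves `1 + t ^ (n + 1)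
  -- * b t`.
  set b : ℝ → ℝ := fun t => (-1) ^ (n + 1) * a t / n.factorial with hb
  have hba : AnalyticAt ℝ b 0 := by
    have : (n.factorial : ℝ) ≠ 0 := by positivity
    simp only [hb]
    exact (analyticAt_const.mul ha).div_const
  obtain ⟨hl, hl0⟩ := iteratedDeriv_log_one_add_pow_mul hba (Nat.lt_succ_of_le hmn)
  have hpos : ∀ᶠ t in 𝓝 (0 : ℝ), 0 < 1 + t ^ (n + 1) * b t := by
    have hc : ContinuousAt (fun t => 1 + t ^ (n + 1) * b t) 0 := by
      have := hba.continuousAt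
      fun_prop
    exact hc.eventually (lt_mem_nhds (by simp))
  have e : (fun t => Real.log
        (Real.exp (-(c * t)) * ((eulerFrobeniusPoly ρ n).eval (Real.exp t) / n.factorial)))
      =ᶠ[𝓝 0] (fun t => -(ρ + c) * t) + ((fun t => ((n : ℝ) + 1) * Real.log (expSlope t))
        + fun t => Real.log (1 + t ^ (n + 1) * b t)) := by
    filter_upwards [h, hpos] with t ht hp
    have hE := expSlope_pos t
    have hf : (n.factorial : ℝ) ≠ 0 := by positivity
    have e1 : Real.exp (-(c * t)) * ((eulerFrobeniusPoly ρ n).eval (Real.exp t) / n.factorial)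
        = Real.exp (-(ρ + c) * t) * (expSlope t ^ (n + 1) * (1 + t ^ (n + 1) * b t)) := by
      have e2 : Real.exp (-(c * t)) = Real.exp (-(ρ + c) * t) * Real.exp (ρ * t) := by
        rw [← Real.exp_add]; ring_nf
      have h3 : (1 - Real.exp t) ^ (n + 1) = (-1) ^ (n + 1) * t ^ (n + 1) * expSlope t ^ (n + 1) := by
        rw [← mul_pow, ← mul_pow, mul_assoc, mul_expSlope]; ring_nf
      rw [e2, mul_assoc, mul_div_assoc', ht, h3, hb]
      field_simp
    rw [e1, Real.log_mul (Real.exp_ne_zero _) (by positivity), Real.log_exp,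
      Real.log_mul (by positivity) hp.ne', Real.log_pow]
    simp
  have hE : AnalyticAt ℝ (fun t => ((n : ℝ) + 1) * Real.log (expSlope t)) 0 :=
    analyticAt_const.mul analyticAt_log_expSlope
  rw [e.iteratedDeriv_eq, iteratedDeriv_add (by fun_prop) (hE.add hl).contDiffAt,
    iteratedDeriv_add hE.contDiffAt hl.contDiffAt, hl0, iteratedDeriv_const_mul_field, iteratedDeriv_const_mul_field,
    iteratedDeriv_log_expSlope hm, iteratedDeriv_fun_id_zero]
  split_ifs <;> ring

/-! ### Backward differences, truncated powers and B-splines -/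

/-- The `n`-th iterated backward difference of `h` with unit step. -/
noncomputable def backwardDiff (h : ℝ → ℝ) : ℕ → ℝ → ℝ
  | 0, x => h x
  | n + 1, x => backwardDiff h n x - backwardDiff h n (x - 1)

/-- The truncated power function `x ↦ x₊ ^ n`. -/
noncomputable def truncPow (n : ℕ) (x : ℝ) : ℝ := max x 0 ^ n

/-- The case `n = 0` is excluded because `0 ^ 0 = 1` makes `truncPow 0` constant rather than a step
function. The inductions below therefore start at `n = 1`. -/
theorem truncPow_of_nonpos {n : ℕ} (hn : n ≠ 0) {x : ℝ} (hx : x ≤ 0) : truncPow n x = 0 := by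
  simp [truncPow, max_eq_right hx, hn]

theorem mul_truncPow {n : ℕ} (hn : n ≠ 0) (x : ℝ) : x * truncPow n x = truncPow (n + 1) x := by
  rcases le_total x 0 with h | h
  · rw [truncPow_of_nonpos hn h, truncPow_of_nonpos (by omega) h, mul_zero]
  · simp only [truncPow, max_eq_left h]; ring

theorem continuous_truncPow (n : ℕ) : Continuous (truncPow n) := by
  unfold truncPow; fun_prop

theorem continuous_backwardDiff {h : ℝ → ℝ} (hh : Continuous h) (n : ℕ) :
    Continuous (backwardDiff h n) := by
  induction n with
  | zero => exact hh
  | succ n ih =>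
    simp only [funext_iff.2 fun x => backwardDiff.eq_2 h x n] at *
    exact ih.sub (ih.comp (continuous_sub_right 1))

theorem backwardDiff_of_nonpos {h : ℝ → ℝ} (hh : ∀ x ≤ 0, h x = 0) (n : ℕ) {x : ℝ}
    (hx : x ≤ 0) : backwardDiff h n x = 0 := by
  induction n generalizing x with
  | zero => exact hh x hx
  | succ n ih => rw [backwardDiff, ih hx, ih (by linarith), sub_zero]

/-- The Leibniz rule for the backward difference of `x ↦ x * h x`. -/
theorem backwardDiff_id_mul (h : ℝ → ℝ) (n : ℕ) (x : ℝ) :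
    backwardDiff (fun y => y * h y) (n + 1) x
      = x * backwardDiff h (n + 1) x + (n + 1) * backwardDiff h n (x - 1) := by
  induction n generalizing x with
  | zero => simp only [backwardDiff]; push_cast; ring
  | succ n ih =>
    rw [backwardDiff, ih, ih, backwardDiff.eq_2 h x (n + 1), backwardDiff.eq_2 h (x - 1) n]
    push_cast
    ring

/-- Averaging over a unit interval is itself a backward difference, of an antiderivative `H`, and it
commutes with the other differences. -/
theorem integral_backwardDiff {h H : ℝ → ℝ} (hc : Continuous h)
    (hH : ∀ x, ∫ u in (0 : ℝ)..1, h (x - u) = H x - H (x - 1)) (n : ℕ) (x : ℝ) :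
    ∫ u in (0 : ℝ)..1, backwardDiff h n (x - u) = backwardDiff H (n + 1) x := by
  induction n generalizing x with
  | zero => simpa [backwardDiff] using hH x
  | succ n ih =>
    have hb := continuous_backwardDiff hc n
    have e : ∀ u, backwardDiff h (n + 1) (x - u)
        = backwardDiff h n (x - u) - backwardDiff h n (x - 1 - u) := by
      intro u; rw [backwardDiff]; ring_nf
    simp only [e]
    rw [intervalIntegral.integral_sub
      (Continuous.intervalIntegrable (by fun_prop) _ _)
      (Continuous.intervalIntegrable (by fun_prop) _ _), ih, ih]
    rfl

theorem integral_truncPow (n : ℕ) (hn : n ≠ 0) (b : ℝ) :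
    ∫ u in (0 : ℝ)..b, truncPow n u = truncPow (n + 1) b / (n + 1) := by
  rcases le_total b 0 with h | h
  · rw [intervalIntegral.integral_congr (g := fun _ => 0), truncPow_of_nonpos (by omega) h]
    · simp
    · intro u hu
      rw [Set.uIcc_of_ge h] at hu
      exact truncPow_of_nonpos hn hu.2
  · rw [intervalIntegral.integral_congr (g := fun u => u ^ n)]
    · simp [truncPow, max_eq_left h]
    · intro u hu
      rw [Set.uIcc_of_le h] at hu
      simp [truncPow, max_eq_left hu.1]

theorem integral_truncPow_sub (n : ℕ) (hn : n ≠ 0) (x : ℝ) :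
    ∫ u in (0 : ℝ)..1, truncPow n (x - u)
      = truncPow (n + 1) x / (n + 1) - truncPow (n + 1) (x - 1) / (n + 1) := by
  have hi : ∀ a b, IntervalIntegrable (truncPow n) volume a b := fun a b =>
    (continuous_truncPow n).intervalIntegrable a b
  rw [intervalIntegral.integral_comp_sub_left (fun u => truncPow n u), sub_zero,
    ← integral_truncPow n hn, ← integral_truncPow n hn,
    intervalIntegral.integral_interval_sub_left (hi _ _) (hi _ _)]

theorem backwardDiff_div (h : ℝ → ℝ) (c : ℝ) (n : ℕ) (x : ℝ) :
    backwardDiff (fun y => h y / c) n x = backwardDiff h n x / c := by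
  induction n generalizing x with
  | zero => rfl
  | succ n ih => rw [backwardDiff, ih, ih, backwardDiff, sub_div]

/-- The distribution function of a sum of `n` independent uniform random variables. -/
noncomputable def uniformSumCDF (n : ℕ) (x : ℝ) : ℝ :=
  backwardDiff (truncPow n) n x / n.factorial

theorem continuous_uniformSumCDF (n : ℕ) : Continuous (uniformSumCDF n) :=
  (continuous_backwardDiff (continuous_truncPow n) n).div_const _

theorem integral_uniformSumCDF {n : ℕ} (hn : n ≠ 0) (x : ℝ) :
    ∫ u in (0 : ℝ)..1, uniformSumCDF n (x - u) = uniformSumCDF (n + 1) x := by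
  simp only [uniformSumCDF]
  rw [intervalIntegral.integral_div,
    integral_backwardDiff (H := fun y => truncPow (n + 1) y / (n + 1)) (continuous_truncPow n)
      (integral_truncPow_sub n hn), backwardDiff_div, Nat.factorial_succ]
  push_cast
  rw [div_div]

/-- Euler–Frobenius numbers are values of a cardinal B-spline. -/
theorem eulerFrobeniusNumber_eq_backwardDiff {n : ℕ} (hn : n ≠ 0) (k : ℕ) {ρ : ℝ} (h0 : 0 ≤ ρ)
    (h1 : ρ ≤ 1) :
    eulerFrobeniusNumber n k ρ = backwardDiff (truncPow n) (n + 1) (k + ρ) := by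
  induction n generalizing k with
  | zero => exact absurd rfl hn
  | succ n ih =>
    rcases eq_or_ne n 0 with rfl | hn0
    · have hz : ∀ k, eulerFrobeniusNumber 0 k ρ = if k = 0 then 1 else 0 := by
        intro k
        simp [eulerFrobeniusNumber, eulerFrobeniusPoly, coeff_one]
      rcases k with _ | _ | k
      · rw [eulerFrobeniusNumber_succ_zero, hz]
        simp only [backwardDiff, truncPow, zero_add, pow_one]
        push_cast
        rw [max_eq_left (by linarith), max_eq_right (by linarith), max_eq_right (by linarith)]
        simp
      · rw [eulerFrobeniusNumber_succ_succ, hz, hz]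
        simp only [backwardDiff, truncPow, zero_add, pow_one]
        push_cast
        rw [max_eq_left (by linarith), max_eq_left (by linarith), max_eq_right (by linarith)]
        simp
      · rw [eulerFrobeniusNumber_succ_succ, hz, hz]
        have hk : (0 : ℝ) ≤ k := by positivity
        simp only [backwardDiff, truncPow, zero_add, pow_one]
        push_cast
        rw [max_eq_left (by linarith), max_eq_left (by linarith), max_eq_left (by linarith)]
        simp
    · have ih := ih hn0
      -- The B-spline recurrence: the Leibniz rule with `x * x₊ ^ n = x₊ ^ (n + 1)`. At `x = k + 1 +
      -- ρ` its coefficients are those of `eulerFrobeniusNumber_succ_succ`.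
      have hrec : ∀ x, backwardDiff (truncPow (n + 1)) (n + 2) x
          = x * backwardDiff (truncPow n) (n + 1) x
            + (n + 2 - x) * backwardDiff (truncPow n) (n + 1) (x - 1) := by
        intro x
        have := backwardDiff_id_mul (truncPow n) (n + 1) x
        simp only [mul_truncPow hn0] at this
        rw [this, backwardDiff]
        push_cast
        ring
      rw [hrec]
      rcases k with _ | k
      · rw [eulerFrobeniusNumber_succ_zero, ih,
          backwardDiff_of_nonpos (x := ((0 : ℕ) : ℝ) + ρ - 1)
            (fun x hx => truncPow_of_nonpos hn0 hx) _ (by push_cast; linarith)]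
        simp
      · rw [eulerFrobeniusNumber_succ_succ, ih, ih]
        push_cast
        rw [show (k : ℝ) + 1 + ρ - 1 = k + ρ by ring]
        ring

/-! ### Laws of the uniform sum and of its rounding -/

theorem cond_volume_Icc_zero_one :
    ProbabilityTheory.cond volume (Set.Icc (0 : ℝ) 1) = volume.restrict (Set.Icc 0 1) := by
  simp [ProbabilityTheory.cond]

section UniformSum

variable {Ω : Type*} [MeasurableSpace Ω] {Q : Measure Ω}

theorem hasLaw_of_isUniform {U : Ω → ℝ} (hU : pdf.IsUniform U (Set.Icc 0 1) Q volume) :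
    HasLaw U (volume.restrict (Set.Icc 0 1)) Q where
  aemeasurable := hU.aemeasurable (by simp) (by simp)
  map_eq := by rw [← cond_volume_Icc_zero_one]; exact hU

theorem volume_Icc_inter_Iio (x : ℝ) :
    (volume.restrict (Set.Icc (0 : ℝ) 1)).real (Set.Iio x) = uniformSumCDF 1 x := by
  have e : uniformSumCDF 1 x = max x 0 - max (x - 1) 0 := by
    simp [uniformSumCDF, backwardDiff, truncPow]
  rw [e, measureReal_restrict_apply measurableSet_Iio]
  rcases le_or_gt x 1 with h | h
  · have : Set.Iio x ∩ Set.Icc 0 1 = Set.Ico 0 x := by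
      ext y; simp only [Set.mem_inter_iff, Set.mem_Iio, Set.mem_Icc, Set.mem_Ico]
      constructor
      · rintro ⟨a, b, c⟩; exact ⟨b, a⟩
      · rintro ⟨a, b⟩; exact ⟨b, a, by linarith⟩
    rw [this, Real.volume_real_Ico, max_eq_right (by linarith : x - 1 ≤ 0)]
    simp
  · have : Set.Iio x ∩ Set.Icc 0 1 = Set.Icc 0 1 := by
      ext y; simp only [Set.mem_inter_iff, Set.mem_Iio, Set.mem_Icc]
      constructor
      · rintro ⟨a, b⟩; exact b
      · rintro b; exact ⟨by linarith [b.2], b⟩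
    rw [this, Real.volume_real_Icc, max_eq_left (by linarith : 0 ≤ x),
      max_eq_left (by linarith : 0 ≤ x - 1)]
    simp

/-- Conditioning on the last summand gives `F_{n+1}(x) = ∫₀¹ F_n(x - u) du`, which `uniformSumCDF`
satisfies. Open half-lines `Iio` fit the half-open intervals on which the floor is constant. -/
theorem measureReal_uniformSum_lt [IsProbabilityMeasure Q] {U : ℕ → Ω → ℝ}
    (hUindep : iIndepFun U Q)
    (hUunif : ∀ i, pdf.IsUniform (U i) (Set.Icc 0 1) Q volume) {n : ℕ} (hn : n ≠ 0) (x : ℝ) :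
    (Q.map (∑ i ∈ Finset.range n, U i)).real (Set.Iio x) = uniformSumCDF n x := by
  have hlaw := fun i => hasLaw_of_isUniform (hUunif i)
  have hm : ∀ i, AEMeasurable (U i) Q := fun i => (hlaw i).aemeasurable
  induction n generalizing x with
  | zero => exact absurd rfl hn
  | succ n ih =>
    rcases eq_or_ne n 0 with rfl | hn0
    · rw [Finset.sum_range_one, (hlaw 0).map_eq]
      exact volume_Icc_inter_Iio x
    · have ih := ih hn0
      have hS : AEMeasurable (∑ i ∈ Finset.range n, U i) Q :=
        Finset.aemeasurable_sum _ fun i _ => hm i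
      set μ := Q.map (∑ i ∈ Finset.range n, U i) with hμ
      have : IsProbabilityMeasure μ := Measure.isProbabilityMeasure_map hS
      have hadd := IndepFun.hasLaw_add (hlaw n) ⟨hS, hμ.symm⟩
        (hUindep.indepFun_sum_range_succ₀ hm n).symm
      rw [Finset.sum_range_succ, add_comm, hadd.map_eq]
      have hnn : ∀ y, 0 ≤ uniformSumCDF n y := fun y => by rw [← ih]; exact measureReal_nonneg
      have hshift : ∀ u, ∫⁻ y, (Set.Iio x).indicator 1 (u + y) ∂μ
          = ENNReal.ofReal (uniformSumCDF n (x - u)) := by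
        intro u
        have e : (fun y => (Set.Iio x).indicator (1 : ℝ → ENNReal) (u + y))
            = (Set.Iio (x - u)).indicator 1 := by
          ext y
          simp only [Set.indicator, Set.mem_Iio, lt_sub_iff_add_lt']
          rfl
        rw [e, lintegral_indicator_one measurableSet_Iio, ← ih, measureReal_def,
          ENNReal.ofReal_toReal (measure_ne_top _ _)]
      have hconv : (volume.restrict (Set.Icc (0 : ℝ) 1) ∗ μ) (Set.Iio x)
          = ENNReal.ofReal (uniformSumCDF (n + 1) x) := by
        rw [← lintegral_indicator_one measurableSet_Iio, Measure.lintegral_conv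
          (measurable_one.indicator measurableSet_Iio)]
        simp only [hshift]
        have hc : Continuous fun u => uniformSumCDF n (x - u) :=
          (continuous_uniformSumCDF n).comp (continuous_sub_left x)
        rw [← ofReal_integral_eq_lintegral_ofReal (hc.integrableOn_Icc)
          (Filter.Eventually.of_forall fun u => hnn _), integral_Icc_eq_integral_Ioc,
          ← intervalIntegral.integral_of_le zero_le_one, integral_uniformSumCDF hn0]
      rw [measureReal_def, hconv, ENNReal.toReal_ofReal]
      rw [← integral_uniformSumCDF hn0]
      exact intervalIntegral.integral_nonneg zero_le_one fun u _ => hnn _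

end UniformSum

theorem eulerFrobeniusDistUnit_singleton_natCast (n k : ℕ) (ρ : ℝ) :
    eulerFrobeniusDistUnit n ρ {(k : ℤ)}
      = ENNReal.ofReal (eulerFrobeniusNumber n k ρ / n.factorial) := by
  simp only [eulerFrobeniusDistUnit, Measure.finsetSum_apply, Measure.smul_apply, smul_eq_mul]
  by_cases hk : k ≤ n
  · rw [Finset.sum_eq_single_of_mem k (Finset.mem_range.2 (by omega))]
    · simp
    · intro j _ hj
      simp [hj]
  · rw [eulerFrobeniusNumber_eq_zero (by omega)]
    simp only [zero_div, ENNReal.ofReal_zero]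
    refine Finset.sum_eq_zero fun j hj => ?_
    have : j ≠ k := by have := Finset.mem_range.1 hj; omega
    simp [this]

theorem eulerFrobeniusDistUnit_singleton_of_neg (n : ℕ) (ρ : ℝ) {k : ℤ} (hk : k < 0) :
    eulerFrobeniusDistUnit n ρ {k} = 0 := by
  simp only [eulerFrobeniusDistUnit, Measure.finsetSum_apply, Measure.smul_apply, smul_eq_mul]
  refine Finset.sum_eq_zero fun j _ => ?_
  have : (j : ℤ) ≠ k := by omega
  simp [this]

theorem hasLaw_floor_uniformSum {Ω : Type*} [MeasurableSpace Ω] {Q : Measure Ω}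
    [IsProbabilityMeasure Q] {U : ℕ → Ω → ℝ} (hUindep : iIndepFun U Q)
    (hUunif : ∀ i, pdf.IsUniform (U i) (Set.Icc 0 1) Q volume) {n : ℕ} (hn : n ≠ 0) (ρ : ℝ) :
    HasLaw (fun ω => ⌊(∑ i ∈ Finset.range n, U i ω) + 1 - ρ⌋) (eulerFrobeniusDist n ρ) Q := by
  have hm : ∀ i, AEMeasurable (U i) Q := fun i => (hasLaw_of_isUniform (hUunif i)).aemeasurable
  have hS : AEMeasurable (∑ i ∈ Finset.range n, U i) Q :=
    Finset.aemeasurable_sum _ fun i _ => hm i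
  set r := Int.fract ρ with hr
  have hr0 : 0 ≤ r := Int.fract_nonneg ρ
  have hr1 : r ≤ 1 := (Int.fract_lt_one ρ).le
  have hfm : Measurable fun s : ℝ => ⌊s + 1 - r⌋ := by fun_prop
  have hunit : HasLaw (fun s : ℝ => ⌊s + 1 - r⌋) (eulerFrobeniusDistUnit n r)
      (Q.map (∑ i ∈ Finset.range n, U i)) := by
    refine ⟨hfm.aemeasurable, Measure.ext_of_singleton fun k => ?_⟩
    have : IsProbabilityMeasure (Q.map (∑ i ∈ Finset.range n, U i)) :=
      Measure.isProbabilityMeasure_map hS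
    -- The mass at `k` is `F(k + r) - F(k + r - 1)`, a backward difference of order `n + 1` at `k +
    -- r`.
    have hpre : (fun s : ℝ => ⌊s + 1 - r⌋) ⁻¹' {k}
        = Set.Iio (k + r) \ Set.Iio (k + r - 1) := by
      ext s
      simp only [Set.mem_preimage, Set.mem_singleton_iff, Int.floor_eq_iff, Set.mem_sdiff,
        Set.mem_Iio, not_lt]
      constructor
      · rintro ⟨a, b⟩; constructor <;> linarith
      · rintro ⟨a, b⟩; constructor <;> linarith
    rw [Measure.map_apply hfm (measurableSet_singleton k), hpre, ← ofReal_measureReal,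
      measureReal_sdiff (Set.Iio_subset_Iio (by linarith)) measurableSet_Iio,
      measureReal_uniformSum_lt hUindep hUunif hn, measureReal_uniformSum_lt hUindep hUunif hn,
      uniformSumCDF, uniformSumCDF, ← sub_div, ← backwardDiff]
    rcases lt_or_ge k 0 with hk | hk
    · have hk' : (k : ℝ) ≤ -1 := by exact_mod_cast (by omega : k ≤ -1)
      rw [eulerFrobeniusDistUnit_singleton_of_neg n r hk, backwardDiff_of_nonpos
        (fun x hx => truncPow_of_nonpos hn hx) _ (by linarith)]
      simp
    · lift k to ℕ using hk
      rw [eulerFrobeniusDistUnit_singleton_natCast,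
        eulerFrobeniusNumber_eq_backwardDiff hn k hr0 hr1]
      simp
  have hshift : HasLaw (fun k : ℤ => k - ⌊ρ⌋) (eulerFrobeniusDist n ρ)
      (eulerFrobeniusDistUnit n r) := ⟨by fun_prop, rfl⟩
  refine (hshift.fun_comp (hunit.fun_comp ⟨hS, rfl⟩)).congr
    (Filter.Eventually.of_forall fun ω => ?_)
  simp only [Finset.sum_apply]
  rw [← Int.floor_sub_intCast]
  congr 1
  have := Int.self_sub_floor ρ
  linarith

/-! ### Moment generating functions and cumulants -/

theorem integrable_eulerFrobeniusDistUnit (n : ℕ) (ρ : ℝ) (f : ℤ → ℝ) :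
    Integrable f (eulerFrobeniusDistUnit n ρ) :=
  integrable_finsetSum_measure.2 fun _ _ => (integrable_dirac (by simp)).smul_measure (by simp)

theorem integrable_eulerFrobeniusDist (n : ℕ) (ρ : ℝ) (f : ℤ → ℝ) :
    Integrable f (eulerFrobeniusDist n ρ) :=
  (integrable_map_measure (.of_discrete) (by fun_prop)).2
    (integrable_eulerFrobeniusDistUnit n _ _)

theorem integral_exp_eulerFrobeniusDist (n : ℕ) (ρ t : ℝ) :
    ∫ k, Real.exp (t * (k : ℝ)) ∂(eulerFrobeniusDist n ρ)
      = Real.exp (-(⌊ρ⌋ * t))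
        * ((eulerFrobeniusPoly (Int.fract ρ) n).eval (Real.exp t) / n.factorial) := by
  rw [eulerFrobeniusDist, integral_map (by fun_prop) .of_discrete, eulerFrobeniusDistUnit,
    integral_finsetSum_measure
      fun _ _ => (integrable_dirac (by simp)).smul_measure (by simp),
    eval_eq_sum_range' (Nat.lt_succ_of_le (eulerFrobeniusPoly_natDegree_le _ n)),
    Finset.sum_div, Finset.mul_sum]
  refine Finset.sum_congr rfl fun k _ => ?_
  -- `ENNReal.ofReal` truncates negative numbers to `0`; nonnegativity, valid for a parameter in
  -- `[0, 1]`, recovers the actual weight.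
  have hnn : 0 ≤ eulerFrobeniusNumber n k (Int.fract ρ) / n.factorial :=
    div_nonneg (eulerFrobeniusNumber_nonneg n k (Int.fract_nonneg ρ) (Int.fract_lt_one ρ).le)
      (by positivity)
  rw [integral_smul_measure, integral_dirac, ENNReal.toReal_ofReal hnn, ← Real.exp_nat_mul,
    smul_eq_mul, eulerFrobeniusNumber]
  have e : Real.exp (t * (((k : ℤ) - ⌊ρ⌋ : ℤ) : ℝ))
      = Real.exp (-(⌊ρ⌋ * t)) * Real.exp (k * t) := by
    rw [← Real.exp_add]
    push_cast
    ring_nf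
  rw [e]
  ring

section Cumulants

variable {Ω : Type*} [MeasurableSpace Ω] {P : Measure Ω}

theorem mgf_of_hasLaw_eulerFrobeniusDist {ρ : ℝ} {n : ℕ} {X : Ω → ℤ}
    (hX : HasLaw X (eulerFrobeniusDist n ρ) P) (t : ℝ) :
    mgf (fun ω => (X ω : ℝ)) P t = Real.exp (-(⌊ρ⌋ * t))
        * ((eulerFrobeniusPoly (Int.fract ρ) n).eval (Real.exp t) / n.factorial) := by
  rw [← integral_exp_eulerFrobeniusDist]
  exact hX.integral_comp (f := fun k : ℤ => Real.exp (t * (k : ℝ))) .of_discrete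

theorem cumulant_of_hasLaw_eulerFrobeniusDist {ρ : ℝ} {n m : ℕ} {X : Ω → ℤ}
    (hX : HasLaw X (eulerFrobeniusDist n ρ) P) (hm : 1 ≤ m) (hmn : m ≤ n) :
    cumulant m (fun ω => (X ω : ℝ)) P
      = (n + 1) * (bernoulli' m : ℝ) / m - if m = 1 then ρ else 0 := by
  -- The polynomial contributes the fractional part of `ρ` and the shift contributes the floor; only
  -- their sum appears in the result.
  have h := iteratedDeriv_log_eval_eulerFrobeniusPoly (Int.fract ρ) ⌊ρ⌋ hm hmn
  rw [Int.fract_add_floor] at h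
  rw [← h, cumulant]
  congr 1
  ext t
  rw [cgf, mgf_of_hasLaw_eulerFrobeniusDist hX]

theorem mgf_of_isUniform {U : Ω → ℝ} (hU : pdf.IsUniform U (Set.Icc 0 1) P volume) (t : ℝ) :
    mgf U P t = expSlope t := by
  have h : mgf U P t = ∫ u in (0 : ℝ)..1, Real.exp (t * u) := by
    rw [intervalIntegral.integral_of_le zero_le_one, ← integral_Icc_eq_integral_Ioc]
    exact (hasLaw_of_isUniform hU).integral_comp (f := fun u : ℝ => Real.exp (t * u))
      (by fun_prop)
  rw [h]
  rcases eq_or_ne t 0 with rfl | ht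
  · simp [expSlope_zero]
  · rw [intervalIntegral.integral_comp_mul_left _ ht, integral_exp]
    refine mul_left_cancel₀ ht ?_
    rw [mul_expSlope]
    simp [ht]

theorem cumulant_of_isUniform {U : Ω → ℝ} (hU : pdf.IsUniform U (Set.Icc 0 1) P volume)
    {m : ℕ} (hm : 1 ≤ m) : cumulant m U P = (bernoulli' m : ℝ) / m := by
  rw [← iteratedDeriv_log_expSlope hm, cumulant]
  congr 1
  ext t
  rw [cgf, mgf_of_isUniform hU]

theorem cumulant_uniformSum {U : ℕ → Ω → ℝ} (hUindep : iIndepFun U P)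
    (hUunif : ∀ i, pdf.IsUniform (U i) (Set.Icc 0 1) P volume) (n : ℕ) {m : ℕ} (hm : 1 ≤ m) :
    cumulant m (fun ω => ∑ i ∈ Finset.range n, U i ω) P = n * ((bernoulli' m : ℝ) / m) := by
  rw [← iteratedDeriv_log_expSlope hm, ← iteratedDeriv_const_mul_field, cumulant]
  congr 1
  ext t
  have e : (fun ω => ∑ i ∈ Finset.range n, U i ω) = ∑ i ∈ Finset.range n, U i := by
    ext ω; simp
  rw [cgf, e, hUindep.mgf_sum₀ fun i => (hasLaw_of_isUniform (hUunif i)).aemeasurable]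
  simp [mgf_of_isUniform (hUunif _), Real.log_pow]

end Cumulants

/-! ### The main theorem -/

theorem mainTheorem6 (ρ : ℝ) (n : ℕ)
    {Ω : Type*} [MeasurableSpace Ω] (P : Measure Ω) [IsProbabilityMeasure P]
    (X : Ω → ℤ) (hX : HasLaw X (eulerFrobeniusDist n ρ) P)
    {Ω' : Type*} [MeasurableSpace Ω'] (Q : Measure Ω') [IsProbabilityMeasure Q]
    (U : ℕ → Ω' → ℝ) (hUindep : iIndepFun U Q)
    (hUunif : ∀ i, pdf.IsUniform (U i) (Set.Icc 0 1) Q volume) :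
    -- all exponential moments of `X` are finite
    (∀ t : ℝ, Integrable (fun ω => Real.exp (t * (X ω : ℝ))) P) ∧
    -- the rounded sum `⌊U₁ + ⋯ + Uₙ + 1 - ρ⌋` has the same law as `X`
    (1 ≤ n → HasLaw (fun ω => ⌊(∑ i ∈ Finset.range n, U i ω) + 1 - ρ⌋)
      (eulerFrobeniusDist n ρ) Q) ∧
    (1 ≤ n → Integrable (fun ω => (X ω : ℝ)) P ∧
      ∫ ω, (X ω : ℝ) ∂P = ((n : ℝ) + 1) / 2 - ρ) ∧
    (2 ≤ n → variance (fun ω => (X ω : ℝ)) P = ((n : ℝ) + 1) / 12) ∧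
    (∀ m : ℕ, 2 ≤ m → m ≤ n →
      cumulant m (fun ω => (X ω : ℝ)) P
          = cumulant m (fun ω => ∑ i ∈ Finset.range (n + 1), U i ω) Q ∧
      (∀ i, cumulant m (fun ω => ∑ i ∈ Finset.range (n + 1), U i ω) Q
          = ((n : ℝ) + 1) * cumulant m (U i) Q) ∧
      cumulant m (fun ω => (X ω : ℝ)) P = ((n : ℝ) + 1) * (_root_.bernoulli m : ℝ) / (m : ℝ)) ∧
    (∀ m : ℕ, Odd m → 3 ≤ m → m ≤ n → cumulant m (fun ω => (X ω : ℝ)) P = 0) := by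
  have hint : ∀ f : ℤ → ℝ, Integrable (fun ω => f (X ω)) P := fun f =>
    (integrable_map_measure .of_discrete hX.aemeasurable).1
      (hX.map_eq ▸ integrable_eulerFrobeniusDist n ρ f)
  have hexp : ∀ t : ℝ, Integrable (fun ω => Real.exp (t * (X ω : ℝ))) P := fun t =>
    hint fun k => Real.exp (t * (k : ℝ))
  -- Interiority of `0` allows the first two derivatives of the cumulant generating function there
  -- to be read as mean and variance.
  have hmem : (0 : ℝ) ∈ interior (integrableExpSet (fun ω => (X ω : ℝ)) P) := by
    rw [show integrableExpSet (fun ω => (X ω : ℝ)) P = Set.univ from Set.eq_univ_of_forall hexp]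
    simp
  have hcum : ∀ m : ℕ, 2 ≤ m → m ≤ n → cumulant m (fun ω => (X ω : ℝ)) P
      = ((n : ℝ) + 1) * (_root_.bernoulli m : ℝ) / (m : ℝ) := by
    intro m hm hmn
    rw [cumulant_of_hasLaw_eulerFrobeniusDist hX (by omega) hmn,
      bernoulli_eq_bernoulli'_of_ne_one (by omega), if_neg (by omega), sub_zero]
  refine ⟨hexp, fun hn => hasLaw_floor_uniformSum hUindep hUunif (by omega) ρ,
    fun hn => ⟨hint fun k => (k : ℝ), ?_⟩, fun hn => ?_, fun m hm hmn => ⟨?_, fun i => ?_,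
    hcum m hm hmn⟩, fun m hodd hm hmn => ?_⟩
  · have h1 := cumulant_of_hasLaw_eulerFrobeniusDist hX le_rfl hn
    rw [cumulant, iteratedDeriv_one, deriv_cgf_zero hmem] at h1
    simp only [probReal_univ, div_one, bernoulli'_one, if_true] at h1
    rw [h1]
    push_cast
    ring
  · have h2 := hcum 2 le_rfl hn
    -- The second derivative of the cumulant generating function at `t` is the variance under the
    -- measure tilted by `t X`; at `t = 0` the tilt is trivial.
    rw [cumulant, ← variance_tilted_mul hmem, bernoulli_two] at h2
    simp only [zero_mul, tilted_const] at h2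
    rw [h2]
    push_cast
    ring
  · rw [cumulant_of_hasLaw_eulerFrobeniusDist hX (by omega) hmn,
      cumulant_uniformSum hUindep hUunif _ (by omega), if_neg (by omega)]
    push_cast
    ring
  · rw [cumulant_uniformSum hUindep hUunif _ (by omega),
      cumulant_of_isUniform (hUunif i) (by omega)]
    push_cast
    ring
  · rw [hcum m (by omega) hmn, bernoulli_eq_zero_of_odd hodd (by omega)]
    simp
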